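/- For a finite group $G$ let $\mu(G)$ denote its minimal faithful permutation degree, that is, the least non-negative integer $n$ such that $G$ embeds in the symmetric group $\mathrm{Sym}(n)$. For primes $p$ and $q$ let $C_p$ be the cyclic group of order $p$, let $$A(p,p,q)=\{(\theta_1,\ldots,\theta_q)\in C_p^{\,q} \mid \theta_1\theta_2\cdots\theta_q=1\},$$ and let $G(p,p,q)=A(p,p,q)\rtimes \mathrm{Sym}(q)$, where $\mathrm{Sym}(q)$ acts by permuting the coordinates. Theorem. If $p$ and $q$ are odd primes with $p<q$, then $\mu(G(p,p,q))=pq$. -/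

import Mathlib

/-- The minimal faithful permutation degree `μ(G)`: the least `n` such that `G` embeds in the
symmetric group on `n` letters. For a finite group such an `n` always exists. -/
noncomputable def minPermDegree (G : Type*) [Group G] : ℕ :=
  sInf {n : ℕ | ∃ f : G →* Equiv.Perm (Fin n), Function.Injective f}

/-- The group `A(m, d, n)`, for `d` a divisor of `m`: all `θ` in the direct product of `n` copies of
the cyclic group `C_m` of order `m` with `(θ₁ ⋯ θₙ) ^ (m / d) = 1`. -/
def monomialA (m d n : ℕ) : Subgroup (Fin n → Multiplicative (ZMod m)) where
  carrier := {θ | (∏ i, θ i) ^ (m / d) = 1}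
  one_mem' := by simp
  mul_mem' := by
    intro a b ha hb
    simp only [Set.mem_ofPred_eq] at ha hb ⊢
    simp only [Pi.mul_apply, Finset.prod_mul_distrib, mul_pow, ha, hb, mul_one]
  inv_mem' := by
    intro a ha
    simp only [Set.mem_ofPred_eq] at ha ⊢
    simp only [Pi.inv_apply, Finset.prod_inv_distrib, inv_pow, ha, inv_one]

theorem monomialA_perm_mem {m d n : ℕ} (σ : Equiv.Perm (Fin n))
    {θ : Fin n → Multiplicative (ZMod m)} (hθ : θ ∈ monomialA m d n) :
    (fun i => θ (σ.symm i)) ∈ monomialA m d n := by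
  change (∏ i, θ (σ.symm i)) ^ (m / d) = 1
  rw [Equiv.prod_comp σ.symm θ]
  exact hθ

/-- The action of the symmetric group on `A(m, d, n)` by permuting the coordinates. -/
def monomialAction (m d n : ℕ) : Equiv.Perm (Fin n) →* MulAut (monomialA m d n) where
  toFun σ :=
    { toFun := fun θ => ⟨fun i => θ.1 (σ.symm i), monomialA_perm_mem σ θ.2⟩
      invFun := fun θ => ⟨fun i => θ.1 (σ i), monomialA_perm_mem σ.symm θ.2⟩
      left_inv := fun θ => by ext i; simp
      right_inv := fun θ => by ext i; simp
      map_mul' := fun _ _ => rfl }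
  map_one' := rfl
  map_mul' _ _ := rfl

/-- The monomial reflection group `G(m, d, n) = A(m, d, n) ⋊ Sym(n)`. -/
abbrev MonomialGroup (m d n : ℕ) : Type :=
  monomialA m d n ⋊[monomialAction m d n] Equiv.Perm (Fin n)

/-! Write A for A(p,p,q). The upper bound is the imprimitive action on q blocks of size p
(`monomialPermHom`). For the lower bound, a faithful action has a point whose stabilizer H does not
contain A, and such an H has index at least pq (`mul_le_index_of_not_range_inl_le`). If HA has index
at least q, the p-power index of H ∩ A in A supplies the missing factor p. Otherwise HA contains all
elements of order q, hence all three-cycles; these normalize H ∩ A, which is then trivial by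
irreducibility of A, so the index is at least |A| ≥ p^(q-1) ≥ pq. -/

section Irreducibility

variable {ι M : Type*} [Fintype ι] [DecidableEq ι] [CommGroup M]

/-- A subgroup of `ι → M` is stable under three-cycles if it is preserved by every permutation of
the coordinates that is a three-cycle. -/
def ThreeCycleStable (B : Subgroup (ι → M)) : Prop :=
  ∀ σ : Equiv.Perm ι, σ.IsThreeCycle → ∀ b ∈ B, (fun i => b (σ i)) ∈ B

theorem isThreeCycle_swap_mul_swap {i j k : ι} (hij : i ≠ j) (hik : i ≠ k) (hjk : j ≠ k) :
    (Equiv.swap i j * Equiv.swap i k).IsThreeCycle :=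
  Equiv.Perm.isThreeCycle_swap_mul_swap_same hij hik hjk

theorem exists_notMem_of_card_lt {s : Finset ι} (h : s.card < Fintype.card ι) : ∃ a, a ∉ s := by
  by_contra! hc
  exact absurd (Finset.card_le_card (fun x _ => hc x : Finset.univ ⊆ s)) (by simpa using h)

/-- Take differences twice, along three-cycles whose supports meet only in `j`. -/
theorem ThreeCycleStable.exists_mulSingle_mem {B : Subgroup (ι → M)} (hB : ThreeCycleStable B)
    (hι : 5 ≤ Fintype.card ι) {b : ι → M} (hb : b ∈ B) {i j : ι} (hij : b i ≠ b j) :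
    ∃ x : M, x ≠ 1 ∧ ∃ l : ι, l ≠ j ∧ Pi.mulSingle l x * Pi.mulSingle j x⁻¹ ∈ B := by
  have hne : i ≠ j := fun h => hij (by rw [h])
  obtain ⟨k, hk⟩ := exists_notMem_of_card_lt (s := {i, j})
    (lt_of_le_of_lt Finset.card_le_two (by omega))
  obtain ⟨l, hl⟩ := exists_notMem_of_card_lt (s := {i, j, k})
    (lt_of_le_of_lt Finset.card_le_three (by omega))
  obtain ⟨m, hm⟩ := exists_notMem_of_card_lt (s := {i, j, k, l})
    (lt_of_le_of_lt Finset.card_le_four (by omega))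
  simp only [Finset.mem_insert, Finset.mem_singleton, not_or, ← ne_eq] at hk hl hm
  obtain ⟨hki, hkj⟩ := hk
  obtain ⟨hli, hlj, hlk⟩ := hl
  obtain ⟨hmi, hmj, hmk, hml⟩ := hm
  let σ := Equiv.swap i j * Equiv.swap i k
  have hd : (fun a => b (σ a)) / b ∈ B :=
    B.div_mem (hB σ (isThreeCycle_swap_mul_swap hne hki.symm hkj.symm) b hb) hb
  let d : ι → M := (fun a => b (σ a)) / b
  have hdj : d j = b i / b j := by
    simp [d, σ, Equiv.swap_apply_of_ne_of_ne hne.symm hkj.symm]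
  have hd1 : ∀ a, a ≠ i → a ≠ j → a ≠ k → d a = 1 := by
    intro a h1 h2 h3
    simp [d, σ, Equiv.swap_apply_of_ne_of_ne h1 h2, Equiv.swap_apply_of_ne_of_ne h1 h3]
  -- As `d` is trivial at `l` and `m`, `τ` only carries its value at `j` over to `l`.
  let τ := Equiv.swap j l * Equiv.swap j m
  have he : (fun a => d (τ a)) / d ∈ B :=
    B.div_mem (hB τ (isThreeCycle_swap_mul_swap hlj.symm hmj.symm hml.symm) d hd) hd
  refine ⟨d j, by rw [hdj]; exact fun h => hij (div_eq_one.mp h), l, hlj, ?_⟩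
  convert he using 1
  funext a
  by_cases haj : a = j
  · subst haj
    simp [τ, Equiv.swap_apply_of_ne_of_ne hmj hml, hd1 m hmi hmj hmk, hlj.symm]
  by_cases hal : a = l
  · subst hal
    simp [τ, Equiv.swap_apply_of_ne_of_ne hlj hml.symm, hd1 a hli hlj hlk, hlj]
  by_cases ham : a = m
  · subst ham
    simp [τ, hd1 a hmi hmj hmk, hd1 l hli hlj hlk, haj, hal]
  · simp [τ, Equiv.swap_apply_of_ne_of_ne haj ham, Equiv.swap_apply_of_ne_of_ne haj hal, haj, hal]

theorem ThreeCycleStable.mulSingle_mem {B : Subgroup (ι → M)} (hB : ThreeCycleStable B)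
    (hι : 4 ≤ Fintype.card ι) {x : M} {l j : ι} (hlj : l ≠ j)
    (h : Pi.mulSingle l x * Pi.mulSingle j x⁻¹ ∈ B) (a : ι) :
    Pi.mulSingle a x * Pi.mulSingle j x⁻¹ ∈ B := by
  by_cases haj : a = j
  · subst haj
    rw [← Pi.mulSingle_mul, mul_inv_cancel, Pi.mulSingle_one]
    exact B.one_mem
  by_cases hal : a = l
  · rwa [hal]
  obtain ⟨c, hc⟩ := exists_notMem_of_card_lt (s := {a, l, j})
    (lt_of_le_of_lt Finset.card_le_three (by omega))
  simp only [Finset.mem_insert, Finset.mem_singleton, not_or, ← ne_eq] at hc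
  obtain ⟨hca, hcl, hcj⟩ := hc
  -- The spare point `c` allows a three-cycle that takes `a` to `l` and fixes `j`.
  let σ := Equiv.swap l a * Equiv.swap l c
  have hσ : σ.IsThreeCycle := isThreeCycle_swap_mul_swap (Ne.symm hal) hcl.symm hca.symm
  have hσl : ∀ i, σ i = l ↔ i = a := fun i => by
    rw [← σ.injective.eq_iff (a := i) (b := a)]
    simp [σ, Equiv.swap_apply_of_ne_of_ne hal hca.symm]
  have hσj : ∀ i, σ i = j ↔ i = j := fun i => by
    rw [← σ.injective.eq_iff (a := i) (b := j)]
    simp [σ, Equiv.swap_apply_of_ne_of_ne hlj.symm hcj.symm,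
      Equiv.swap_apply_of_ne_of_ne hlj.symm (Ne.symm haj)]
  convert hB σ hσ _ h using 1
  funext i
  simp only [Pi.mul_apply, Pi.mulSingle_apply, hσl, hσj]

theorem ThreeCycleStable.mem_of_prod_eq_one {B : Subgroup (ι → M)} (hB : ThreeCycleStable B)
    (hι : 5 ≤ Fintype.card ι) (hM : (Nat.card M).Prime) {b : ι → M} (hb : b ∈ B) {i j : ι}
    (hij : b i ≠ b j) {θ : ι → M} (hθ : ∏ i, θ i = 1) : θ ∈ B := by
  have := Fact.mk hM
  obtain ⟨x, hx, l, hlj, hmem⟩ := hB.exists_mulSingle_mem hι hb hij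
  have hgen : ∀ (y : M) (a : ι), Pi.mulSingle a y * Pi.mulSingle j y⁻¹ ∈ B := by
    intro y a
    obtain ⟨n, rfl⟩ := Subgroup.mem_zpowers_iff.mp (mem_zpowers_of_prime_card (g' := y) rfl hx)
    have := B.zpow_mem (hB.mulSingle_mem (by omega) hlj hmem a) n
    rwa [mul_zpow, ← Pi.mulSingle_zpow, ← Pi.mulSingle_zpow, inv_zpow] at this
  have hprod : ∏ a, (Pi.mulSingle a (θ a) * Pi.mulSingle j (θ a)⁻¹) = θ := by
    rw [Finset.prod_mul_distrib, Finset.univ_prod_mulSingle]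
    have : ∏ a, (Pi.mulSingle j (θ a)⁻¹ : ι → M) = 1 := by
      have := map_prod (MonoidHom.mulSingle (fun _ : ι => M) j) (fun a => (θ a)⁻¹) Finset.univ
      simp only [Finset.prod_inv_distrib, hθ] at this
      simpa using this.symm
    rw [this, mul_one]
  rw [← hprod]
  exact B.prod_mem fun a _ => hgen _ _

end Irreducibility

/-! ### Three-cycles as products of n-torsion permutations -/

section ThreeCycles

/-- A three-cycle on a set of odd size `n ≥ 3` is a product of two elements whose order
divides `n`. -/
theorem isThreeCycle_eq_mul_of_pow_eq_one {n : ℕ} (hn : 3 ≤ n) {σ : Equiv.Perm (Fin n)}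
    (hσ : σ.IsThreeCycle) : ∃ c d : Equiv.Perm (Fin n), c ^ n = 1 ∧ d ^ n = 1 ∧ σ = c * d := by
  have hrot : (finRotate n) ^ n = 1 := by
    obtain ⟨m, rfl⟩ : ∃ m, n = m + 2 := ⟨n - 2, by omega⟩
    have := pow_orderOf_eq_one (finRotate (m + 2))
    rwa [isCycle_finRotate.orderOf, support_finRotate, Finset.card_univ, Fintype.card_fin] at this
  obtain ⟨i, j, k, hij, hjk, hik, h1, h2⟩ : ∃ i j k : Fin n, i ≠ j ∧ j ≠ k ∧ i ≠ k ∧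
      finRotate n i = j ∧ finRotate n j = k := by
    obtain ⟨m, rfl⟩ : ∃ m, n = m + 3 := ⟨n - 3, by omega⟩
    refine ⟨0, 1, 2, ?_, ?_, ?_, ?_, ?_⟩ <;>
      simp [Fin.ext_iff, Fin.val_add, Nat.mod_eq_of_lt (show 2 < m + 3 by omega)]
  set c := finRotate n
  let s := Equiv.swap j k
  have hconj : c⁻¹ * s * c = Equiv.swap i j := by
    have := Equiv.swap_apply_apply c⁻¹ j k
    rw [inv_inv] at this
    rw [← this, ← h2, ← h1]
    simp
  -- The commutator of the rotation with a swap of neighbours is a product of two overlapping swaps.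
  have ht : (c⁻¹ * (s * c * s⁻¹)).IsThreeCycle := by
    have : c⁻¹ * (s * c * s⁻¹) = Equiv.swap j i * Equiv.swap j k := by
      rw [Equiv.swap_comm j i, ← hconj, Equiv.swap_inv]
      group
    rw [this]
    exact isThreeCycle_swap_mul_swap hij.symm hjk hik
  obtain ⟨g, hg⟩ := isConj_iff.mp
    (Equiv.Perm.isConj_iff_cycleType_eq.mpr (ht.cycleType.trans hσ.cycleType.symm))
  refine ⟨g * c⁻¹ * g⁻¹, g * (s * c * s⁻¹) * g⁻¹, ?_, ?_, ?_⟩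
  · rw [conj_pow, inv_pow, hrot]; simp
  · rw [conj_pow, conj_pow, hrot]; simp
  · rw [← hg]; group

end ThreeCycles

/-! ### Subgroups of small index, and joins with abelian normal subgroups -/

section SubgroupIndex

variable {G : Type*} [Group G]

/-- Some `g ^ n` with 0 < n < q lies in `K`; since n is prime to q, Bézout recovers `g`. -/
theorem Subgroup.mem_of_pow_prime_eq_one_of_index_lt {K : Subgroup G} {q : ℕ} (hq : q.Prime)
    (h0 : K.index ≠ 0) (hK : K.index < q) {g : G} (hg : g ^ q = 1) : g ∈ K := by
  obtain ⟨n, hn, hnK, hmem⟩ := K.exists_pow_mem_of_index_ne_zero h0 g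
  have hco : IsCoprime (n : ℤ) (q : ℤ) :=
    Nat.isCoprime_iff_coprime.mpr (Nat.coprime_of_lt_prime hn.ne' (hnK.trans_lt hK) hq).symm
  obtain ⟨u, v, huv⟩ := hco
  have : g = (g ^ n) ^ u * (g ^ q) ^ v := by
    rw [← zpow_natCast, ← zpow_natCast, ← zpow_mul, ← zpow_mul, ← zpow_add, mul_comm (n : ℤ),
      mul_comm (q : ℤ), huv, zpow_one]
  rw [this, hg, one_zpow, mul_one]
  exact K.zpow_mem hmem u

theorem Subgroup.conj_mem_of_mem_sup {H N : Subgroup G} [N.Normal]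
    (hN : ∀ a ∈ N, ∀ b ∈ N, a * b = b * a) {k b : G} (hk : k ∈ H ⊔ N) (hbH : b ∈ H)
    (hbN : b ∈ N) : k * b * k⁻¹ ∈ H := by
  obtain ⟨h, hh, a, ha, rfl⟩ := Subgroup.mem_sup_of_normal_right.mp hk
  have : h * a * b * (h * a)⁻¹ = h * b * h⁻¹ := by
    rw [mul_assoc h a b, hN a ha b hbN]
    group
  rw [this]
  exact H.mul_mem (H.mul_mem hh hbH) (H.inv_mem hh)

end SubgroupIndex

/-! ### The monomial group and its subgroups -/

section Monomial

theorem mem_monomialA_self {p q : ℕ} (hp : 0 < p) {θ : Fin q → Multiplicative (ZMod p)} :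
    θ ∈ monomialA p p q ↔ ∏ i, θ i = 1 := by
  change (∏ i, θ i) ^ (p / p) = 1 ↔ _
  rw [Nat.div_self hp, pow_one]

/-- The action of `(θ, σ) ∈ G(m, d, n)` on `Fin n × ZMod m`, sending `(i, x)` to
`(σ i, θ (σ i) + x)`. -/
def monomialPermHom (m d n : ℕ) : MonomialGroup m d n →* Equiv.Perm (Fin n × ZMod m) where
  toFun g :=
    { toFun := fun x => (g.right x.1, (g.left.1 (g.right x.1)).toAdd + x.2)
      invFun := fun x => (g.right.symm x.1, -(g.left.1 x.1).toAdd + x.2)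
      left_inv := fun x => by simp
      right_inv := fun x => by simp }
  map_one' := by
    ext x <;> simp
  map_mul' g h := by
    refine Equiv.ext fun x => Prod.ext rfl ?_
    change ((g.left.1 (g.right (h.right x.1)) *
      h.left.1 (g.right.symm (g.right (h.right x.1)))).toAdd + x.2) = _
    rw [Equiv.symm_apply_apply, toAdd_mul, add_assoc]
    rfl

theorem monomialPermHom_injective (m d n : ℕ) :
    Function.Injective (monomialPermHom m d n) := by
  rw [injective_iff_map_eq_one]
  intro g hg
  have h : ∀ x : Fin n × ZMod m, (g.right x.1, (g.left.1 (g.right x.1)).toAdd + x.2) = x :=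
    fun x => Equiv.congr_fun hg x
  have hr : g.right = 1 := Equiv.ext fun i => congrArg Prod.fst (h (i, 0))
  refine SemidirectProduct.ext (Subtype.ext (funext fun i => ?_)) hr
  have := congrArg Prod.snd (h (i, 0))
  rw [hr] at this
  simpa using this

theorem card_monomialA_ge {p q : ℕ} (hp : p.Prime) (hq : 0 < q) :
    p ^ (q - 1) ≤ Nat.card (monomialA p p q) := by
  have := Fact.mk hp
  let f : (Fin q → Multiplicative (ZMod p)) →* Multiplicative (ZMod p) :=
    { toFun := fun θ => ∏ i, θ i
      map_one' := by simp
      map_mul' := fun a b => by simp [Finset.prod_mul_distrib] }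
  have hker : f.ker = monomialA p p q := by
    ext θ
    rw [mem_monomialA_self hp.pos]
    rfl
  have h1 := f.ker.card_mul_index
  rw [Subgroup.index_ker, hker] at h1
  have h2 : Nat.card f.range ≤ p := by
    refine (Nat.card_le_card_of_injective _ Subtype.val_injective).trans ?_
    simp [Nat.card_eq_fintype_card]
  have h3 : Nat.card (Fin q → Multiplicative (ZMod p)) = p ^ (q - 1) * p := by
    rw [← pow_succ, Nat.sub_add_cancel hq]
    simp
  rw [h3] at h1
  refine Nat.le_of_mul_le_mul_right (c := p) ?_ hp.pos
  rw [← h1]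
  exact Nat.mul_le_mul_left _ h2

theorem mul_le_pow_sub_one {p q : ℕ} (hp : 3 ≤ p) (hq : 3 ≤ q) : p * q ≤ p ^ (q - 1) := by
  induction q, hq using Nat.le_induction with
  | base => rw [show 3 - 1 = 2 from rfl, sq]; exact Nat.mul_le_mul_left p hp
  | succ n hn ih =>
    obtain ⟨m, rfl⟩ : ∃ m, n = m + 1 := ⟨n - 1, by omega⟩
    simp only [Nat.add_sub_cancel] at ih ⊢
    rw [pow_succ]
    nlinarith [Nat.mul_le_mul_right p ih, Nat.mul_le_mul_left (p * (m + 1)) hp, Nat.zero_le (p * m)]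

/-- The common value of a constant tuple would be killed by both p and q. -/
theorem exists_ne_of_mem_monomialA {p q : ℕ} (hp : p.Prime) (hq : q.Prime) (hpq : p ≠ q)
    {θ : Fin q → Multiplicative (ZMod p)} (hθ : θ ∈ monomialA p p q) (h1 : θ ≠ 1) :
    ∃ i j, θ i ≠ θ j := by
  have := Fact.mk hp
  by_contra! hc
  refine h1 (funext fun i => ?_)
  rw [mem_monomialA_self hp.pos, Finset.prod_congr rfl fun j _ => hc j i] at hθ
  simp only [Finset.prod_const, Finset.card_univ, Fintype.card_fin] at hθ
  have hcard : θ i ^ p = 1 := by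
    have := pow_card_eq_one' (x := θ i)
    simpa [Nat.card_eq_fintype_card] using this
  have hco : Nat.Coprime q p := (Nat.coprime_primes hq hp).mpr hpq.symm
  have := pow_gcd_eq_one.mpr ⟨hθ, hcard⟩
  rwa [hco.gcd_eq_one, pow_one] at this

variable {p q : ℕ}

instance monomialGroup_range_inl_normal (m d n : ℕ) :
    (SemidirectProduct.inl : _ →* MonomialGroup m d n).range.Normal := by
  rw [SemidirectProduct.range_inl_eq_ker_rightHom]
  infer_instance

/-- The trace on `A(p, p, q)` of a subgroup whose join with `A(p, p, q)` has index less than `q` is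
trivial or everything. -/
theorem comap_inl_eq_bot_or_range_le (hp : p.Prime) (hq : q.Prime) (hq5 : 5 ≤ q) (hpq : p ≠ q)
    {H : Subgroup (MonomialGroup p p q)}
    (h0 : (H ⊔ SemidirectProduct.inl.range).index ≠ 0)
    (hlt : (H ⊔ SemidirectProduct.inl.range).index < q) :
    H.comap SemidirectProduct.inl = ⊥ ∨ SemidirectProduct.inl.range ≤ H := by
  rw [or_iff_not_imp_left]
  intro hbot
  obtain ⟨⟨b, hb⟩, hb'⟩ := Subgroup.ne_bot_iff_exists_ne_one.mp hbot
  have hb1 : b ≠ 1 := fun h => hb' (Subtype.ext h)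
  let B : Subgroup (Fin q → Multiplicative (ZMod p)) :=
    (H.comap SemidirectProduct.inl).map (monomialA p p q).subtype
  have hB : ThreeCycleStable B := by
    rintro σ hσ _ ⟨b, hb, rfl⟩
    have hσ' : SemidirectProduct.inr σ.symm ∈ H ⊔ SemidirectProduct.inl.range := by
      obtain ⟨c, d, hc, hd, hcd⟩ := isThreeCycle_eq_mul_of_pow_eq_one (by omega) hσ.inv
      have hmem : ∀ e : Equiv.Perm (Fin q), e ^ q = 1 →
          SemidirectProduct.inr e ∈ H ⊔ SemidirectProduct.inl.range := fun e he =>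
        Subgroup.mem_of_pow_prime_eq_one_of_index_lt hq h0 hlt (by rw [← map_pow, he, map_one])
      change SemidirectProduct.inr σ⁻¹ ∈ _
      rw [hcd, map_mul]
      exact Subgroup.mul_mem _ (hmem c hc) (hmem d hd)
    have hcomm : ∀ a ∈ (SemidirectProduct.inl : _ →* MonomialGroup p p q).range,
        ∀ b ∈ (SemidirectProduct.inl : _ →* MonomialGroup p p q).range, a * b = b * a := by
      rintro _ ⟨a, rfl⟩ _ ⟨b, rfl⟩
      rw [← map_mul, mul_comm, map_mul]
    have := Subgroup.conj_mem_of_mem_sup hcomm hσ' hb ⟨b, rfl⟩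
    rw [← map_inv, ← SemidirectProduct.inl_aut] at this
    exact ⟨_, this, rfl⟩
  obtain ⟨i, j, hij⟩ := exists_ne_of_mem_monomialA hp hq hpq b.2
    fun h => hb1 (Subtype.ext h)
  rintro _ ⟨θ, rfl⟩
  have : θ.1 ∈ B := hB.mem_of_prod_eq_one (by simpa using hq5)
    (by simpa [Nat.card_congr Multiplicative.toAdd] using hp)
    ⟨b, hb, rfl⟩ hij ((mem_monomialA_self hp.pos).mp θ.2)
  obtain ⟨θ', h, h'⟩ := this
  rwa [← Subtype.ext h']

theorem mul_le_index_of_not_range_inl_le (hp : p.Prime) (hq : q.Prime) (hp3 : 3 ≤ p) (hq5 : 5 ≤ q)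
    (hpq : p ≠ q) {H : Subgroup (MonomialGroup p p q)}
    (hH : ¬ SemidirectProduct.inl.range ≤ H) (h0 : H.index ≠ 0) : p * q ≤ H.index := by
  have := Fact.mk hp
  let N : Subgroup (MonomialGroup p p q) := SemidirectProduct.inl.range
  have hmul := Subgroup.relIndex_mul_index (le_sup_left : H ≤ H ⊔ N)
  have hK0 : (H ⊔ N).index ≠ 0 := fun h => h0 (by rw [← hmul, h, mul_zero])
  have hR0 : H.relIndex (H ⊔ N) ≠ 0 := fun h => h0 (by rw [← hmul, h, zero_mul])
  have hle : H.relIndex N ≤ H.relIndex (H ⊔ N) := Subgroup.relIndex_le_of_le_right le_sup_right hR0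
  have hcomap : H.relIndex N = (H.comap SemidirectProduct.inl).index :=
    (Subgroup.index_comap _ _).symm
  rcases lt_or_ge (H ⊔ N).index q with hlt | hge
  · rcases comap_inl_eq_bot_or_range_le hp hq hq5 hpq hK0 hlt with h | h
    · rw [h, Subgroup.index_bot] at hcomap
      calc p * q ≤ p ^ (q - 1) := mul_le_pow_sub_one hp3 (by omega)
        _ ≤ Nat.card (monomialA p p q) := card_monomialA_ge hp hq.pos
        _ = H.relIndex N := hcomap.symm
        _ ≤ H.relIndex (H ⊔ N) := hle
        _ ≤ H.index := Nat.le_of_dvd (Nat.pos_of_ne_zero h0) ⟨_, hmul.symm⟩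
    · exact absurd h hH
  · have hdvd : H.relIndex N ∣ p ^ q := by
      have h1 := (H.comap (SemidirectProduct.inl : _ →* MonomialGroup p p q)).index_dvd_card.trans
        (monomialA p p q).card_subgroup_dvd_card
      rw [hcomap]
      simpa using h1
    have hpR : p ≤ H.relIndex N := by
      obtain ⟨k, -, hk⟩ := (Nat.dvd_prime_pow hp).mp hdvd
      have hk0 : k ≠ 0 := by
        rintro rfl
        exact hH (Subgroup.relIndex_eq_one.mp (by rw [hk, pow_zero]))
      rw [hk]
      exact Nat.le_self_pow hk0 p
    rw [← hmul]
    exact Nat.mul_le_mul (hpR.trans hle) hge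

theorem mul_le_of_injective (hp : p.Prime) (hq : q.Prime) (hp3 : 3 ≤ p) (hq5 : 5 ≤ q)
    (hpq : p ≠ q) {n : ℕ} (f : MonomialGroup p p q →* Equiv.Perm (Fin n))
    (hf : Function.Injective f) : p * q ≤ n := by
  have := Fact.mk hp
  let _ : MulAction (MonomialGroup p p q) (Fin n) := MulAction.compHom (Fin n) f
  have hx : ∃ x : Fin n, ¬ SemidirectProduct.inl.range ≤
      MulAction.stabilizer (MonomialGroup p p q) x := by
    by_contra! hc
    have hone : ∀ θ : monomialA p p q, θ = 1 := by
      intro θ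
      refine SemidirectProduct.inl_injective (φ := monomialAction p p q) (hf ?_)
      rw [map_one, map_one]
      exact Equiv.ext fun x => hc x ⟨θ, rfl⟩
    have hcard : Nat.card (monomialA p p q) ≤ 1 :=
      Finite.card_le_one_iff_subsingleton.mpr ⟨fun a b => by rw [hone a, hone b]⟩
    have := (mul_le_pow_sub_one hp3 (by omega : 3 ≤ q)).trans (card_monomialA_ge hp hq.pos)
    nlinarith
  obtain ⟨x, hx⟩ := hx
  have hidx := MulAction.index_stabilizer (MonomialGroup p p q) x
  have hle : (MulAction.orbit (MonomialGroup p p q) x).ncard ≤ n := by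
    simpa using Set.ncard_le_card (MulAction.orbit (MonomialGroup p p q) x)
  have hne : (MulAction.stabilizer (MonomialGroup p p q) x).index ≠ 0 := by
    rw [hidx]
    exact ((Set.ncard_pos (Set.toFinite _)).mpr ⟨x, MulAction.mem_orbit_self x⟩).ne'
  exact (mul_le_index_of_not_range_inl_le hp hq hp3 hq5 hpq hx hne).trans (hidx.le.trans hle)

end Monomial

theorem theorem3p10 (p q : ℕ) (hp : p.Prime) (hq : q.Prime) (hp_odd : Odd p) (hq_odd : Odd q)
    (hpq : p < q) : minPermDegree (MonomialGroup p p q) = p * q := by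
  have hp3 : 3 ≤ p := by
    have := hp.two_le
    rcases hp_odd with ⟨k, rfl⟩
    omega
  have hq5 : 5 ≤ q := by
    rcases hq_odd with ⟨k, rfl⟩
    omega
  have := Fact.mk hp
  let e : Fin q × ZMod p ≃ Fin (p * q) :=
    Fintype.equivFinOfCardEq (by rw [Fintype.card_prod, Fintype.card_fin, ZMod.card, mul_comm])
  have hmem : p * q ∈ {n : ℕ | ∃ f : MonomialGroup p p q →* Equiv.Perm (Fin n),
      Function.Injective f} :=
    ⟨e.permCongrHom.toMonoidHom.comp (monomialPermHom p p q),
      e.permCongrHom.injective.comp (monomialPermHom_injective p p q)⟩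
  refine le_antisymm (Nat.sInf_le hmem) (le_csInf ⟨_, hmem⟩ ?_)
  rintro n ⟨f, hf⟩
  exact mul_le_of_injective hp hq hp3 hq5 hpq.ne f hf
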